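/- Let $\mathcal Z$ (samples) and $\mathcal F$ (models) be measurable spaces, let $\mathcal M(X)$ denote the set of probability measures on $X$ (with the $\sigma$-algebra generated by the evaluations $\mu\mapsto\mu(B)$), and let $\ell:\mathcal Z\times\mathcal F\to[0,1]$ be a measurable loss. For $Q\in\mathcal M(\mathcal F)$ put $\ell(z,Q)=\mathbb E_{f\sim Q}\,\ell(z,f)$. Let $n,m\ge 1$. Let $\mathcal A$ be a measurable space of stochastic learning algorithms: each $A\in\mathcal A$ maps a dataset $S=(z_1,\dots,z_m)\in\mathcal Z^m$ to a distribution $A(S)\in\mathcal M(\mathcal F)$ over models, measurably in $(A,S)$. A task environment $\tau$ generates random tasks $(D,S)$: a data distribution $D\in\mathcal M(\mathcal Z)$ is drawn at random, and $S$ consists of $m$ i.i.d. samples from $D$. The $n$ training tasks $(D_1,S_1),\dots,(D_n,S_n)$, with $S_i=(z_{i,1},\dots,z_{i,m})$, are drawn i.i.d. from $\tau$. For $\rho\in\mathcal M(\mathcal A)$ define the risk on future tasks and the empirical multi-task risk by $$\mathrm{er}(\rho)=\mathbb E_{A\sim\rho}\,\mathbb E_{(D,S)\sim\tau}\,\mathbb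 E_{z\sim D}\,\ell(z,A(S)),\qquad \widehat{\mathrm{er}}(\rho)=\mathbb E_{A\sim\rho}\,\frac1n\sum_{i=1}^n\frac1m\sum_{j=1}^m\ell(z_{i,j},A(S_i)).$$ Theorem. Fix a meta-prior $\pi\in\mathcal M(\mathcal A)$, a measurable hyper-prior mapping $\mathcal P:\mathcal A\to\mathcal M(\mathcal M(\mathcal F))$ (both independent of the data) and $\delta>0$. Then with probability at least $1-\delta$ over the sampling of the $n$ training tasks, the following holds simultaneously for all meta-posteriors $\rho\in\mathcal M(\mathcal A)$ and all hyper-posterior mappings $\mathcal Q:\mathcal A\to\mathcal M(\mathcal M(\mathcal F))$: $$\mathrm{er}(\rho)\le\widehat{\mathrm{er}}(\rho)+\sqrt{\frac{\mathrm{KL}(\rho\|\pi)+\log\frac{4\sqrt n}{\delta}}{2n}}+\sqrt{\frac{\mathrm{KL}(\rho\|\pi)+\mathbb E_{A\sim\rho}[C(A)]+\log\frac{8mn}{\delta}+1}{2mn}},$$ where $$C(A)=\mathrm{KL}(\mathcal Q(A)\|\mathcal P(A))+\mathbb E_{P\sim\mathcal Q(A)}\sum_{i=1}^n\mathrm{KL}(A(S_i)\|P).$$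 Here $\mathrm{KL}$ takes values in $[0,\infty]$, and the right-hand side is read as $+\infty$ when $\mathrm{KL}(\rho\|\pi)$ or $\mathbb E_{A\sim\rho}[C(A)]$ is infinite. -/

import Mathlib

open MeasureTheory ProbabilityTheory

namespace MetaLearning

noncomputable section

/-- A task with `m` samples: a data distribution `D` on `Z`, and a dataset `S` of `m` points. -/
abbrev Task (Z : Type*) [MeasurableSpace Z] (m : ℕ) : Type _ :=
  ProbabilityMeasure Z × (Fin m → Z)

/-- The Markov kernel `D ↦ D^{⊗ m}`: a dataset of `m` i.i.d. samples from `D`. -/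
def iidKernel (Z : Type*) [MeasurableSpace Z] (m : ℕ) :
    Kernel (ProbabilityMeasure Z) (Fin m → Z) where
  toFun D := Measure.pi fun _ => (D : Measure Z)
  measurable' := by
    refine Measurable.measure_of_isPiSystem_of_isProbabilityMeasure
      generateFrom_pi.symm isPiSystem_pi ?_
    rintro _ ⟨t, ht, rfl⟩
    simp only [Measure.pi_pi]
    refine Finset.measurable_prod _ fun i _ => ?_
    exact (Measure.measurable_coe (ht i (Set.mem_univ i))).comp measurable_subtype_coe

instance (Z : Type*) [MeasurableSpace Z] (m : ℕ) : IsMarkovKernel (iidKernel Z m) :=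
  ⟨fun _ => by dsimp [iidKernel]; infer_instance⟩

/-- The law of a random task `(D, S)` in the environment `τ`: the data distribution `D` is drawn
from `τ`, and then the dataset `S` consists of `m` i.i.d. samples from `D`. -/
def taskLaw {Z : Type*} [MeasurableSpace Z] (τ : ProbabilityMeasure (ProbabilityMeasure Z))
    (m : ℕ) : Measure (Task Z m) :=
  (τ : Measure (ProbabilityMeasure Z)) ⊗ₘ iidKernel Z m

/-- The law of `n` training tasks, drawn independently from the environment `τ`. -/
def trainingLaw {Z : Type*} [MeasurableSpace Z] (τ : ProbabilityMeasure (ProbabilityMeasure Z))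
    (n m : ℕ) : Measure (Fin n → Task Z m) :=
  Measure.pi fun _ => taskLaw τ m

/-- The loss `ℓ(z, Q) = E_{f ∼ Q} ℓ(z, f)` of a stochastic model `Q`. -/
def stochLoss {Z F : Type*} [MeasurableSpace F] (loss : Z → F → ℝ) (z : Z)
    (Q : ProbabilityMeasure F) : ℝ :=
  ∫ f, loss z f ∂(Q : Measure F)

/-- The risk of a meta-posterior `ρ` on future tasks,
`er(ρ) = E_{A ∼ ρ} E_{(D,S)} E_{z ∼ D} ℓ(z, A(S))`.
Here `alg A S` is the distribution over models that the algorithm `A` outputs on `S`. -/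
def futureRisk {Z F 𝓐 : Type*} [MeasurableSpace Z] [MeasurableSpace F] [MeasurableSpace 𝓐] {m : ℕ}
    (loss : Z → F → ℝ) (alg : 𝓐 → (Fin m → Z) → ProbabilityMeasure F)
    (τ : ProbabilityMeasure (ProbabilityMeasure Z)) (ρ : ProbabilityMeasure 𝓐) : ℝ :=
  ∫ A, ∫ t, ∫ z, stochLoss loss z (alg A t.2) ∂(t.1 : Measure Z) ∂(taskLaw τ m) ∂(ρ : Measure 𝓐)

/-- The empirical multi-task risk of a meta-posterior `ρ` on the datasets `S 0, …, S (n - 1)`,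
`E_{A ∼ ρ} (1/n) ∑ i, (1/m) ∑ j, ℓ(z_{i,j}, A(S_i))`. -/
def empiricalRisk {Z F 𝓐 : Type*} [MeasurableSpace F] [MeasurableSpace 𝓐] {n m : ℕ}
    (loss : Z → F → ℝ) (alg : 𝓐 → (Fin m → Z) → ProbabilityMeasure F)
    (S : Fin n → Fin m → Z) (ρ : ProbabilityMeasure 𝓐) : ℝ :=
  ∫ A, (1 / (n : ℝ)) * ∑ i, (1 / (m : ℝ)) * ∑ j, stochLoss loss (S i j) (alg A (S i))
    ∂(ρ : Measure 𝓐)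

/-- The Kullback–Leibler divergence of two probability measures, with values in `[0, ∞]`. -/
def KL {X : Type*} [MeasurableSpace X] (μ ν : ProbabilityMeasure X) : ENNReal :=
  InformationTheory.klDiv (μ : Measure X) (ν : Measure X)

/-- The complexity of an algorithm `A`, with values in `[0, ∞]`:
`KL(𝓠(A) ‖ 𝓟(A)) + E_{P ∼ 𝓠(A)} ∑ i, KL(A(S_i) ‖ P)`. -/
def complexity {Z F 𝓐 : Type*} [MeasurableSpace F] {n m : ℕ}
    (alg : 𝓐 → (Fin m → Z) → ProbabilityMeasure F)
    (𝓠 𝓟 : 𝓐 → ProbabilityMeasure (ProbabilityMeasure F))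
    (S : Fin n → Fin m → Z) (A : 𝓐) : ENNReal :=
  KL (𝓠 A) (𝓟 A) + ∫⁻ P, ∑ i, KL (alg A (S i)) P ∂(𝓠 A : Measure (ProbabilityMeasure F))

end

end MetaLearning

/-!
The gap `er(ρ) - êr(ρ)` is split at the intermediate quantity
`E_{A ∼ ρ} (1/n) ∑ i, E_{z ∼ D_i} ℓ(z, A(S_i))`. The first part compares the risk on a new task with
its average over the `n` i.i.d. training tasks (`exists_event_environment`); the second compares
expected with empirical losses inside the training tasks, where all `n * m` data points are pooled
(`exists_event_withinTask`). Each part fails with probability at most `δ / 2`.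

Both parts are PAC-Bayes bounds of the same kind. For fixed data, the Donsker–Varadhan inequality
bounds `l * E_ρ(gap)` by `KL(ρ ‖ π) + log W l`, where `W l` is the `π`-average of
`exp (l * gap)`, whatever the posterior. By Fubini and Hoeffding's lemma, `W l` has expectation at
most `exp (l ^ 2 / (8 * N))` over the data, with `N = n` or `N = n * m`. In the second part the prior
is hierarchical (`A` from `π`, then `P` from `𝓟 A`, then one model per task from `P`), and the
Donsker–Varadhan inequality is applied once at each level: the divergences that appear are those of
`complexity`. The levels are chained by
`ofReal_integral_sub_log_integral_le_KL_add_lintegral`, which compares lower integrals with those of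
measurable minorants. Hence neither `𝓠` nor the divergences need to be measurable.

There remains the choice of `l`, whose best value `4 * N * gap` depends on the data and on `ρ`.
Markov's inequality is applied to a sum of `exp (-l ^ 2 / (8 * N)) * W l` over `k` values of `l`, where
`N ≤ k ^ 2 ≤ 2 * N`. Rounding to the grid costs `exp (N / (2 * k ^ 2))`, and the total price
`k * exp (N / (2 * k ^ 2))` is at most `2 * √N` (`exists_event_le_sqrt`). This gives the constant
`4 * √n / δ` of the first term exactly, and `4 * √(n * m) / δ ≤ 8 * m * n / δ` in the second.
-/

namespace MetaLearning

/-! ### Integrals against probability measures -/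

lemma integrable_of_forall_mem_Icc {X : Type*} [MeasurableSpace X] {μ : Measure X}
    [IsFiniteMeasure μ] {g : X → ℝ} (hg : Measurable g) {a b : ℝ}
    (hab : ∀ x, g x ∈ Set.Icc a b) : Integrable g μ :=
  Integrable.of_mem_Icc a b hg.aemeasurable (ae_of_all _ hab)

lemma integral_mem_Icc {X : Type*} [MeasurableSpace X] {μ : Measure X}
    [IsProbabilityMeasure μ] {g : X → ℝ} (hg : Measurable g) {a b : ℝ}
    (hab : ∀ x, g x ∈ Set.Icc a b) : ∫ x, g x ∂μ ∈ Set.Icc a b := by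
  have hi : Integrable g μ := integrable_of_forall_mem_Icc hg hab
  constructor
  · simpa using integral_mono (integrable_const a) hi fun x => (hab x).1
  · simpa using integral_mono hi (integrable_const b) fun x => (hab x).2

lemma measurable_integral_probabilityMeasure {X Y : Type*} [MeasurableSpace X]
    [MeasurableSpace Y] {κ : X → ProbabilityMeasure Y} (hκ : Measurable κ) {g : X → Y → ℝ}
    (hg : Measurable (Function.uncurry g)) :
    Measurable fun x => ∫ y, g x y ∂(κ x : Measure Y) := by
  let η : Kernel X Y := ⟨fun x => (κ x : Measure Y), measurable_subtype_coe.comp hκ⟩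
  have : IsMarkovKernel η := ⟨fun x => inferInstanceAs (IsProbabilityMeasure (κ x : Measure Y))⟩
  exact (hg.stronglyMeasurable.integral_kernel_prod_right (κ := η)).measurable

/-- By Fubini, a bound on the averages over `μ` for each fixed `y` passes to any mixture
over `y`. -/
lemma integral_integral_le_of_forall_le {X Y : Type*} [MeasurableSpace X] [MeasurableSpace Y]
    {μ : Measure X} [IsProbabilityMeasure μ] {ν : Measure Y} [IsProbabilityMeasure ν]
    {g : X → Y → ℝ} (hg : Measurable (Function.uncurry g)) {a b C : ℝ}
    (hab : ∀ x y, g x y ∈ Set.Icc a b) (hC : ∀ y, ∫ x, g x y ∂μ ≤ C) :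
    ∫ x, ∫ y, g x y ∂ν ∂μ ≤ C := by
  have hi : Integrable (Function.uncurry g) (μ.prod ν) :=
    integrable_of_forall_mem_Icc hg fun p => hab p.1 p.2
  rw [integral_integral_swap hi]
  simpa using integral_mono hi.integral_prod_right (integrable_const C) hC

lemma integral_pi_prod_le {X : Type*} [MeasurableSpace X] {μ : Measure X}
    [IsProbabilityMeasure μ] (n : ℕ) {φ : X → ℝ} (h0 : ∀ x, 0 ≤ φ x) {c : ℝ}
    (hc : ∫ x, φ x ∂μ ≤ Real.exp c) :
    ∫ x, ∏ i, φ (x i) ∂(Measure.pi fun _ : Fin n => μ) ≤ Real.exp (n * c) := by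
  rw [integral_fintype_prod_eq_pow, Fintype.card_fin, Real.exp_nat_mul]
  exact pow_le_pow_left₀ (integral_nonneg h0) hc n

/-- Hoeffding's lemma for a random variable with values in `[0, 1]`. -/
lemma integral_exp_mul_mean_sub_le {X : Type*} [MeasurableSpace X] {μ : Measure X}
    [IsProbabilityMeasure μ] {g : X → ℝ} (hg : Measurable g)
    (h01 : ∀ x, g x ∈ Set.Icc (0 : ℝ) 1) (s : ℝ) :
    ∫ x, Real.exp (s * (∫ y, g y ∂μ - g x)) ∂μ ≤ Real.exp (s ^ 2 / 8) := by
  have h := (hasSubgaussianMGF_of_mem_Icc (μ := μ) hg.aemeasurable (ae_of_all _ h01)).mgf_le (-s)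
  simp only [mgf] at h
  convert h using 1
  · congr 1; ext x; congr 1; ring
  · congr 1; norm_num; ring

/-! ### Change of measure -/

lemma ofReal_integral_le_lintegral_ofReal {X : Type*} [MeasurableSpace X] {μ : Measure X}
    {g : X → ℝ} (hg : Integrable g μ) :
    ENNReal.ofReal (∫ x, g x ∂μ) ≤ ∫⁻ x, ENNReal.ofReal (g x) ∂μ := by
  have h1 : ∫ x, g x ∂μ ≤ ∫ x, max (g x) 0 ∂μ :=
    integral_mono hg hg.pos_part fun x => le_max_left _ _
  refine (ENNReal.ofReal_le_ofReal h1).trans_eq ?_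
  rw [ofReal_integral_eq_lintegral_ofReal hg.pos_part (ae_of_all _ fun x => le_max_right _ _)]
  simp

/-- The lower bound in the Donsker–Varadhan variational formula, for a bounded function: it is
Gibbs' inequality for `μ` and the exponentially tilted measure `dν' ∝ exp f dν`. -/
lemma ofReal_integral_sub_log_integral_exp_le_KL {X : Type*} [MeasurableSpace X]
    (μ ν : ProbabilityMeasure X) {f : X → ℝ} (hf : Measurable f) {a b : ℝ}
    (hab : ∀ x, f x ∈ Set.Icc a b) :
    ENNReal.ofReal (∫ x, f x ∂(μ : Measure X) - Real.log (∫ x, Real.exp (f x) ∂(ν : Measure X)))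
      ≤ KL μ ν := by
  unfold KL
  by_cases hkl : InformationTheory.klDiv (μ : Measure X) (ν : Measure X) = ⊤
  · simp [hkl]
  obtain ⟨hac, hint⟩ := InformationTheory.klDiv_ne_top_iff.1 hkl
  have hfμ : Integrable f (μ : Measure X) := integrable_of_forall_mem_Icc hf hab
  have hfν : Integrable (fun x => Real.exp (f x)) (ν : Measure X) :=
    integrable_of_forall_mem_Icc hf.exp
      fun x => ⟨Real.exp_le_exp.2 (hab x).1, Real.exp_le_exp.2 (hab x).2⟩
  have : IsProbabilityMeasure ((ν : Measure X).tilted f) := isProbabilityMeasure_tilted hfν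
  have h := InformationTheory.integral_llr_add_sub_measure_univ_nonneg
    (hac.trans (absolutelyContinuous_tilted hfν))
    (integrable_llr_tilted_right hac hfμ hint hfν)
  rw [integral_llr_tilted_right hac hfμ hfν hint] at h
  have hk := InformationTheory.toReal_klDiv_of_measure_eq hac (by simp)
  simp only [probReal_univ] at h
  refine ENNReal.ofReal_le_of_le_toReal ?_
  rw [hk]
  linarith

/-- One level of the PAC-Bayes change of measure. The function `φ` need not be measurable: its
lower integral is compared with that of the measurable minorant `a - log v`. -/
lemma ofReal_integral_sub_log_integral_le_KL_add_lintegral {X : Type*} [MeasurableSpace X]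
    (μ ν : ProbabilityMeasure X) {φ : X → ENNReal} {a v : X → ℝ} (ha : Measurable a)
    (hv : Measurable v) {a₀ a₁ c₀ c₁ : ℝ} (ha01 : ∀ x, a x ∈ Set.Icc a₀ a₁)
    (hc : 0 < c₀) (hv01 : ∀ x, v x ∈ Set.Icc c₀ c₁)
    (h : ∀ x, ENNReal.ofReal (a x - Real.log (v x)) ≤ φ x) :
    ENNReal.ofReal (∫ x, a x ∂(μ : Measure X) - Real.log (∫ x, v x ∂(ν : Measure X)))
      ≤ KL μ ν + ∫⁻ x, φ x ∂(μ : Measure X) := by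
  have hpos : ∀ x, 0 < v x := fun x => hc.trans_le (hv01 x).1
  have hl : ∀ x, Real.log (v x) ∈ Set.Icc (Real.log c₀) (Real.log c₁) := fun x =>
    ⟨Real.log_le_log hc (hv01 x).1, Real.log_le_log (hpos x) (hv01 x).2⟩
  have hKL := ofReal_integral_sub_log_integral_exp_le_KL μ ν hv.log hl
  simp_rw [Real.exp_log (hpos _)] at hKL
  have hia : Integrable a (μ : Measure X) := integrable_of_forall_mem_Icc ha ha01
  have hil : Integrable (fun x => Real.log (v x)) (μ : Measure X) :=
    integrable_of_forall_mem_Icc hv.log hl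
  have hφ : ENNReal.ofReal (∫ x, (a x - Real.log (v x)) ∂(μ : Measure X))
      ≤ ∫⁻ x, φ x ∂(μ : Measure X) :=
    (ofReal_integral_le_lintegral_ofReal (hia.sub hil)).trans (lintegral_mono h)
  rw [integral_sub hia hil] at hφ
  refine le_trans ?_ (add_le_add hKL hφ)
  refine le_trans (ENNReal.ofReal_le_ofReal ?_) ENNReal.ofReal_add_le
  linarith

/-! ### Optimizing over the inverse temperature -/

/-- There is a grid on `[0, 1]` with spacing `1 / k` between `1 / √(2 N)` and `1 / √N`. -/
lemma exists_sq_mem_Icc {N : ℕ} (hN : 0 < N) : ∃ k : ℕ, 0 < k ∧ N ≤ k ^ 2 ∧ k ^ 2 ≤ 2 * N := by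
  obtain ⟨r, hr⟩ : ∃ r, r = Nat.sqrt (N - 1) := ⟨_, rfl⟩
  have h1 : r * r ≤ N - 1 := hr ▸ Nat.sqrt_le _
  have h2 : N - 1 < (r + 1) * (r + 1) := hr ▸ Nat.lt_succ_sqrt _
  refine ⟨r + 1, by omega, ?_, ?_⟩
  · nlinarith [Nat.sub_add_cancel hN]
  · have : r * r + 1 ≤ N := by omega
    rcases Nat.lt_or_ge r 2 with h | h
    · interval_cases r <;> omega
    · nlinarith

lemma exp_le_four_mul {w : ℝ} (h0 : 1 / 2 ≤ w) (h1 : w ≤ 1) : Real.exp w ≤ 4 * w := by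
  have he : Real.exp 1 < 2.7182818286 := Real.exp_one_lt_d9
  have hh : Real.exp (1 / 2) ≤ 2 := by
    have : Real.exp (1 / 2) ^ 2 = Real.exp 1 := by rw [← Real.exp_nat_mul]; norm_num
    nlinarith [Real.exp_pos (1 / 2)]
  have hc := convexOn_exp.2 (Set.mem_univ (1 / 2 : ℝ)) (Set.mem_univ (1 : ℝ))
    (by linarith : 0 ≤ 2 - 2 * w) (by linarith : 0 ≤ 2 * w - 1) (by ring)
  simp only [smul_eq_mul] at hc
  rw [show (2 - 2 * w) * (1 / 2) + (2 * w - 1) * 1 = w by ring] at hc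
  nlinarith

lemma exists_grid_point {k : ℕ} (hk : 0 < k) {x : ℝ} (h0 : 0 < x) (h1 : x ≤ 1) :
    ∃ j : Fin k, |(2 * (j : ℝ) + 1) / (2 * k) - x| ≤ 1 / (2 * k) := by
  have hk' : (0 : ℝ) < k := by exact_mod_cast hk
  have hc : 0 < ⌈k * x⌉₊ := Nat.ceil_pos.2 (by positivity)
  have hle : ⌈k * x⌉₊ ≤ k := Nat.ceil_le.2 (by nlinarith)
  refine ⟨⟨⌈k * x⌉₊ - 1, by omega⟩, ?_⟩
  have h2 := Nat.le_ceil (k * x)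
  have h3 := Nat.ceil_lt_add_one (a := k * x) (by positivity)
  simp only [Nat.cast_sub (Nat.one_le_iff_ne_zero.2 hc.ne'), Nat.cast_one]
  rw [show (2 * ((⌈k * x⌉₊ : ℝ) - 1) + 1) / (2 * k) - x
    = (2 * (⌈k * x⌉₊ - k * x) - 1) / (2 * k) by field_simp; ring]
  rw [abs_div, abs_of_pos (by positivity : (0 : ℝ) < 2 * k)]
  gcongr
  rw [abs_le]
  constructor <;> linarith

/-- The optimization over the inverse temperature `l`. The optimal `l = 4 N x` depends on the
unknown `x`, so Markov's inequality is applied to the sum of `W l` over a grid of `k` values. -/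
lemma exists_event_le_sqrt {Ω : Type*} [MeasurableSpace Ω] {μ : Measure Ω}
    [IsProbabilityMeasure μ] {N : ℕ} (hN : 0 < N) {W : ℝ → Ω → ℝ}
    (hW : ∀ l, Measurable (W l)) (hWi : ∀ l, Integrable (W l) μ) (hpos : ∀ l ω, 0 < W l ω)
    (hmom : ∀ l, ∫ ω, W l ω ∂μ ≤ Real.exp (l ^ 2 / (8 * N))) {δ : ℝ} (hδ : 0 < δ) :
    ∃ G : Set Ω, MeasurableSet G ∧ μ.real Gᶜ ≤ δ ∧ ∀ ω ∈ G, ∀ x K : ℝ, x ≤ 1 →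
      (∀ l, l * x - Real.log (W l ω) ≤ K) →
      x ≤ √((K + Real.log (2 * √(N : ℝ) / δ)) / (2 * N)) := by
  obtain ⟨k, hk, hNk, hkN⟩ := exists_sq_mem_Icc hN
  have hN' : (0 : ℝ) < N := by exact_mod_cast hN
  have hk' : (0 : ℝ) < k := by exact_mod_cast hk
  have hNk' : (N : ℝ) ≤ k ^ 2 := by exact_mod_cast hNk
  have hkN' : (k : ℝ) ^ 2 ≤ 2 * N := by exact_mod_cast hkN
  let l : Fin k → ℝ := fun j => 4 * N * ((2 * (j : ℝ) + 1) / (2 * k))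
  let T : Ω → ℝ := fun ω => ∑ j, Real.exp (-(l j ^ 2 / (8 * N))) * W (l j) ω
  have hTm : Measurable T := Finset.measurable_sum _ fun j _ => (hW _).const_mul _
  have hterm : ∀ j ω, 0 < Real.exp (-(l j ^ 2 / (8 * N))) * W (l j) ω :=
    fun j ω => mul_pos (Real.exp_pos _) (hpos _ _)
  have hT : ∫ ω, T ω ∂μ ≤ k := by
    simp only [T]
    rw [integral_finsetSum _ fun j _ => (hWi _).const_mul _]
    calc _ ≤ ∑ _j : Fin k, (1 : ℝ) := Finset.sum_le_sum fun j _ => by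
            rw [integral_const_mul]
            calc _ ≤ Real.exp (-(l j ^ 2 / (8 * N))) * Real.exp (l j ^ 2 / (8 * N)) := by
                    gcongr; exact hmom _
              _ = 1 := by rw [← Real.exp_add]; simp
      _ = k := by simp
  refine ⟨{ω | T ω < k / δ}, measurableSet_lt hTm measurable_const, ?_, ?_⟩
  · have hM := mul_meas_ge_le_integral_of_nonneg (μ := μ)
      (ae_of_all _ fun ω => (Finset.sum_nonneg fun j _ => (hterm j ω).le : 0 ≤ T ω))
      (integrable_finsetSum _ fun j _ => (hWi _).const_mul _) (k / δ)
    have hset : {ω | T ω < k / δ}ᶜ = {ω | k / δ ≤ T ω} := by ext; simp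
    rw [hset]
    have := hM.trans hT
    rw [div_mul_eq_mul_div, div_le_iff₀ hδ] at this
    exact le_of_mul_le_mul_left this hk'
  · intro ω hω x K hx1 hx
    rcases le_or_gt x 0 with hx0 | hx0
    · exact hx0.trans (Real.sqrt_nonneg _)
    obtain ⟨j, hj⟩ := exists_grid_point hk hx0 hx1
    have hWj : Real.exp (-(l j ^ 2 / (8 * N))) * W (l j) ω ≤ k / δ :=
      (Finset.single_le_sum (fun j _ => (hterm j ω).le) (Finset.mem_univ j)).trans
        (le_of_lt hω)
    have hlog := Real.log_le_log (hterm j ω) hWj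
    rw [Real.log_mul (Real.exp_pos _).ne' (hpos _ _).ne', Real.log_exp] at hlog
    have hxj := hx (l j)
    -- completing the square, with `u` the grid point next to `x`
    set u : ℝ := (2 * (j : ℝ) + 1) / (2 * k) with hu
    have hlj : l j = 4 * N * u := rfl
    have hsq : (u - x) ^ 2 ≤ (1 / (2 * k)) ^ 2 := sq_le_sq' (neg_le_of_abs_le hj) (le_of_abs_le hj)
    have hquad : l j * x - l j ^ 2 / (8 * N) = 2 * N * x ^ 2 - 2 * N * (u - x) ^ 2 := by
      rw [hlj]; field_simp; ring
    have hgap : 2 * N * (u - x) ^ 2 ≤ (N / k ^ 2 : ℝ) / 2 := by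
      calc _ ≤ 2 * N * (1 / (2 * k : ℝ)) ^ 2 := by gcongr
        _ = _ := by field_simp
    -- the price `k * exp (N / (2 * k ^ 2))` of the grid is at most `2 * √N`
    have hprice : (N / k ^ 2 : ℝ) / 2 + Real.log (k / δ) ≤ Real.log (2 * √(N : ℝ) / δ) := by
      rw [Real.log_div hk'.ne' hδ.ne', Real.log_div (by positivity) hδ.ne']
      have hw : Real.exp (N / k ^ 2 : ℝ) ≤ 4 * (N / k ^ 2) :=
        exp_le_four_mul (by rw [le_div_iff₀ (by positivity)]; linarith)
          (by rw [div_le_one (by positivity)]; exact hNk')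
      have hw' := Real.log_le_log (Real.exp_pos _) hw
      have e1 : Real.log (4 * (N / k ^ 2 : ℝ)) = 2 * Real.log (2 * √(N : ℝ)) - 2 * Real.log k := by
        rw [← mul_div_assoc, Real.log_div (by positivity) (by positivity), Real.log_pow,
          show (4 * N : ℝ) = (2 * √(N : ℝ)) ^ 2 by rw [mul_pow, Real.sq_sqrt hN'.le]; norm_num,
          Real.log_pow]
        norm_num
      rw [Real.log_exp, e1] at hw'
      linarith
    refine Real.le_sqrt_of_sq_le ?_
    rw [le_div_iff₀ (by positivity)]
    linarith

/-! ### The laws of the tasks -/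

lemma integral_taskLaw_le {Z : Type*} [MeasurableSpace Z]
    (τ : ProbabilityMeasure (ProbabilityMeasure Z)) (m : ℕ) {g : Task Z m → ℝ}
    (hg : Measurable g) {a b C : ℝ} (hab : ∀ t, g t ∈ Set.Icc a b)
    (hC : ∀ D : ProbabilityMeasure Z,
      ∫ S, g (D, S) ∂(Measure.pi fun _ : Fin m => (D : Measure Z)) ≤ C) :
    ∫ t, g t ∂(taskLaw τ m) ≤ C := by
  have hi : Integrable g ((τ : Measure (ProbabilityMeasure Z)) ⊗ₘ iidKernel Z m) :=
    integrable_of_forall_mem_Icc hg hab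
  rw [taskLaw, Measure.integral_compProd hi]
  simpa using integral_mono hi.integral_compProd (integrable_const C) hC

instance {Z : Type*} [MeasurableSpace Z] (τ : ProbabilityMeasure (ProbabilityMeasure Z))
    (m : ℕ) : IsProbabilityMeasure (taskLaw τ m) := by
  unfold taskLaw; infer_instance

instance {Z : Type*} [MeasurableSpace Z] (τ : ProbabilityMeasure (ProbabilityMeasure Z))
    (n m : ℕ) : IsProbabilityMeasure (trainingLaw τ n m) := by
  unfold trainingLaw; infer_instance

/-! ### Elementary bounds -/

lemma exp_mul_mem_Icc {s x : ℝ} (hx : x ∈ Set.Icc (-1 : ℝ) 1) :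
    Real.exp (s * x) ∈ Set.Icc (Real.exp (-|s|)) (Real.exp |s|) := by
  have h : |s * x| ≤ |s| := by
    rw [abs_mul]; exact mul_le_of_le_one_right (abs_nonneg s) (abs_le.2 hx)
  exact ⟨Real.exp_le_exp.2 (abs_le.1 h).1, Real.exp_le_exp.2 (abs_le.1 h).2⟩

lemma prod_mem_Icc_pow {n : ℕ} {a b : ℝ} (ha : 0 ≤ a) {g : Fin n → ℝ}
    (hg : ∀ i, g i ∈ Set.Icc a b) : ∏ i, g i ∈ Set.Icc (a ^ n) (b ^ n) := by
  constructor
  · simpa using Finset.prod_le_prod (s := Finset.univ) (fun i _ => ha) fun i _ => (hg i).1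
  · simpa using Finset.prod_le_prod (s := Finset.univ) (fun i _ => ha.trans (hg i).1)
      fun i _ => (hg i).2

lemma average_mem_Icc {n : ℕ} (hn : 0 < n) {a b : ℝ} {g : Fin n → ℝ}
    (hg : ∀ i, g i ∈ Set.Icc a b) : (1 / (n : ℝ)) * ∑ i, g i ∈ Set.Icc a b := by
  have hn' : (0 : ℝ) < n := by exact_mod_cast hn
  have h1 : ∑ _i : Fin n, a ≤ ∑ i, g i := Finset.sum_le_sum fun i _ => (hg i).1
  have h2 : ∑ i, g i ≤ ∑ _i : Fin n, b := Finset.sum_le_sum fun i _ => (hg i).2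
  simp only [Finset.sum_const, Finset.card_univ, Fintype.card_fin, nsmul_eq_mul] at h1 h2
  rw [one_div_mul_eq_div, Set.mem_Icc, le_div_iff₀ hn', div_le_iff₀ hn']
  constructor <;> linarith

/-- Hoeffding's moment bound for the deviation of an average of `n` i.i.d. variables `r (t i)` with
values in `[0, 1]`. It serves over the tasks of the environment and over the points of a dataset. -/
lemma integral_prod_exp_mean_sub_le {X : Type*} [MeasurableSpace X] {μ : Measure X}
    [IsProbabilityMeasure μ] {n : ℕ} (hn : 0 < n) {r : X → ℝ} (hr : Measurable r)
    (h01 : ∀ x, r x ∈ Set.Icc (0 : ℝ) 1) (l : ℝ) :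
    ∫ t, ∏ i, Real.exp (l / n * (∫ x, r x ∂μ - r (t i))) ∂(Measure.pi fun _ : Fin n => μ)
      ≤ Real.exp (l ^ 2 / (8 * n)) := by
  refine (integral_pi_prod_le n (φ := fun x => Real.exp (l / n * (∫ x, r x ∂μ - r x)))
    (fun x => (Real.exp_pos _).le) (integral_exp_mul_mean_sub_le hr h01 (l / n))).trans_eq ?_
  have hn' : (n : ℝ) ≠ 0 := by exact_mod_cast hn.ne'
  congr 1
  field_simp

/-! ### Generalization to new tasks -/

section Environment

variable {Z 𝓐 : Type*} [MeasurableSpace Z] [MeasurableSpace 𝓐] {n m : ℕ}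

/-- PAC-Bayes bound at the environment level: the training tasks are `n` i.i.d. samples, and
`r t A` is the risk of the algorithm `A` on the task `t`. -/
lemma exists_event_environment (hn : 0 < n) (τ : ProbabilityMeasure (ProbabilityMeasure Z))
    (π : ProbabilityMeasure 𝓐) {r : Task Z m → 𝓐 → ℝ} (hr : Measurable (Function.uncurry r))
    (h01 : ∀ t A, r t A ∈ Set.Icc (0 : ℝ) 1) {δ : ℝ} (hδ : 0 < δ) :
    ∃ G : Set (Fin n → Task Z m), MeasurableSet G ∧ (trainingLaw τ n m).real Gᶜ ≤ δ ∧
      ∀ t ∈ G, ∀ ρ : ProbabilityMeasure 𝓐, KL ρ π ≠ ⊤ →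
        ∫ A, ∫ s, r s A ∂(taskLaw τ m) ∂(ρ : Measure 𝓐)
          - ∫ A, (1 / (n : ℝ)) * ∑ i, r (t i) A ∂(ρ : Measure 𝓐)
        ≤ √(((KL ρ π).toReal + Real.log (2 * √(n : ℝ) / δ)) / (2 * n)) := by
  have hrA : ∀ A, Measurable fun s => r s A := fun A => hr.of_uncurry_right
  set R : 𝓐 → ℝ := fun A => ∫ s, r s A ∂(taskLaw τ m)
  have hRm : Measurable R :=
    (hr.comp measurable_swap).stronglyMeasurable.integral_prod_right'.measurable
  have hR01 : ∀ A, R A ∈ Set.Icc (0 : ℝ) 1 := fun A => integral_mem_Icc (hrA A) fun s => h01 s A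
  have hd : ∀ s A, R A - r s A ∈ Set.Icc (-1 : ℝ) 1 := fun s A =>
    ⟨by linarith [(hR01 A).1, (h01 s A).2], by linarith [(hR01 A).2, (h01 s A).1]⟩
  let v : ℝ → (Fin n → Task Z m) → 𝓐 → ℝ := fun l t A =>
    ∏ i, Real.exp (l / n * (R A - r (t i) A))
  have hvm : ∀ (l : ℝ), Measurable (Function.uncurry (v l)) := fun l =>
    Finset.measurable_prod _ fun i _ => (((hRm.comp measurable_snd).sub (hr.comp
      (f := fun p : (Fin n → Task Z m) × 𝓐 => (p.1 i, p.2)) (by fun_prop))).const_mul _).exp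
  have hv : ∀ (l : ℝ) t A, v l t A ∈ Set.Icc (Real.exp (-|l / n|) ^ n) (Real.exp |l / n| ^ n) :=
    fun l t A => prod_mem_Icc_pow (Real.exp_pos _).le fun i => exp_mul_mem_Icc (hd _ _)
  let W : ℝ → (Fin n → Task Z m) → ℝ := fun l t => ∫ A, v l t A ∂(π : Measure 𝓐)
  have hWm : ∀ (l : ℝ), Measurable (W l) := fun l =>
    measurable_integral_probabilityMeasure (κ := fun _ => π) measurable_const (hvm l)
  have hW : ∀ (l : ℝ) t, W l t ∈ Set.Icc (Real.exp (-|l / n|) ^ n) (Real.exp |l / n| ^ n) :=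
    fun l t => integral_mem_Icc ((hvm l).of_uncurry_left) (hv l t)
  have hmom : ∀ (l : ℝ), ∫ t, W l t ∂(trainingLaw τ n m) ≤ Real.exp (l ^ 2 / (8 * n)) := fun l =>
    integral_integral_le_of_forall_le (hvm l) (hv l) fun A =>
      integral_prod_exp_mean_sub_le hn (hrA A) (fun s => h01 s A) l
  obtain ⟨G, hG, hGδ, hGx⟩ := exists_event_le_sqrt hn hWm
    (fun l => integrable_of_forall_mem_Icc (hWm l) (hW l))
    (fun l t => (by positivity : (0 : ℝ) < Real.exp (-|l / n|) ^ n).trans_le (hW l t).1) hmom hδ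
  refine ⟨G, hG, hGδ, fun t ht ρ hρ => ?_⟩
  let g : 𝓐 → ℝ := fun A => R A - (1 / (n : ℝ)) * ∑ i, r (t i) A
  have hrt : ∀ i, Measurable (r (t i)) := fun i => hr.of_uncurry_left
  have hem : Measurable fun A => (1 / (n : ℝ)) * ∑ i, r (t i) A :=
    (Finset.measurable_sum _ fun i _ => hrt i).const_mul _
  have he01 : ∀ A, (1 / (n : ℝ)) * ∑ i, r (t i) A ∈ Set.Icc (0 : ℝ) 1 :=
    fun A => average_mem_Icc hn fun i => h01 (t i) A
  have hgm : Measurable g := hRm.sub hem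
  have hg : ∀ A, g A ∈ Set.Icc (-1 : ℝ) 1 := fun A =>
    ⟨by linarith [(hR01 A).1, (he01 A).2], by linarith [(hR01 A).2, (he01 A).1]⟩
  rw [← integral_sub (integrable_of_forall_mem_Icc hRm hR01)
    (integrable_of_forall_mem_Icc hem he01)]
  refine hGx t ht _ _ (integral_mem_Icc hgm hg).2 fun l => ?_
  have hlg : ∀ A, Real.log (v l t A) = l * g A := fun A => by
    have hn' : (n : ℝ) ≠ 0 := by exact_mod_cast hn.ne'
    simp only [v, g]
    rw [← Real.exp_sum, Real.log_exp, ← Finset.mul_sum, Finset.sum_sub_distrib]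
    simp
    field_simp
  have h := ofReal_integral_sub_log_integral_exp_le_KL ρ π (f := fun A => Real.log (v l t A))
    ((hvm l).of_uncurry_left).log
    (a := Real.log (Real.exp (-|l / n|) ^ n)) (b := Real.log (Real.exp |l / n| ^ n)) fun A =>
      ⟨Real.log_le_log (by positivity) (hv l t A).1,
        Real.log_le_log (lt_of_lt_of_le (by positivity) (hv l t A).1) (hv l t A).2⟩
  simp_rw [Real.exp_log (lt_of_lt_of_le (by positivity) (hv l t _).1), hlg] at h
  rw [integral_const_mul] at h
  exact (ENNReal.ofReal_le_iff_le_toReal hρ).1 h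

end Environment

/-! ### Generalization within the training tasks -/

section WithinTask

variable {Z F 𝓐 : Type*} [MeasurableSpace Z] [MeasurableSpace F] [MeasurableSpace 𝓐] {n m : ℕ}

/-- The generalization gap of the model `f` on the task `t = (D, S)`: its expected loss under `D`
minus its average loss on the dataset `S`. -/
noncomputable def generalizationGap (loss : Z → F → ℝ) (t : Task Z m) (f : F) : ℝ :=
  ∫ z, loss z f ∂(t.1 : Measure Z) - (1 / (m : ℝ)) * ∑ j, loss (t.2 j) f

lemma measurable_generalizationGap {loss : Z → F → ℝ}
    (hloss : Measurable (Function.uncurry loss)) :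
    Measurable (Function.uncurry (generalizationGap (m := m) loss)) := by
  refine Measurable.sub ?_ ((Finset.measurable_sum _ fun j _ => ?_).const_mul _)
  · exact measurable_integral_probabilityMeasure (X := Task Z m × F) (κ := fun p => p.1.1)
      (g := fun p z => loss z p.2) (by fun_prop)
      (hloss.comp (measurable_snd.prodMk (measurable_snd.comp measurable_fst)))
  · exact hloss.comp (f := fun p : Task Z m × F => (p.1.2 j, p.2)) (by fun_prop)

lemma generalizationGap_mem_Icc (hm : 0 < m) {loss : Z → F → ℝ}
    (hloss : Measurable (Function.uncurry loss)) (hloss01 : ∀ z f, loss z f ∈ Set.Icc (0 : ℝ) 1)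
    (t : Task Z m) (f : F) : generalizationGap loss t f ∈ Set.Icc (-1 : ℝ) 1 := by
  have h1 : ∫ z, loss z f ∂(t.1 : Measure Z) ∈ Set.Icc (0 : ℝ) 1 :=
    integral_mem_Icc hloss.of_uncurry_right fun z => hloss01 z f
  have h2 := average_mem_Icc hm fun j => hloss01 (t.2 j) f
  unfold generalizationGap
  exact ⟨by linarith [h1.1, h2.2], by linarith [h1.2, h2.1]⟩

/-- The within-task moment bound: for a fixed model the gap averages `m` independent terms. -/
lemma integral_exp_generalizationGap_le (hm : 0 < m) {loss : Z → F → ℝ}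
    (hloss : Measurable (Function.uncurry loss)) (hloss01 : ∀ z f, loss z f ∈ Set.Icc (0 : ℝ) 1)
    (τ : ProbabilityMeasure (ProbabilityMeasure Z)) (s : ℝ) (f : F) :
    ∫ t, Real.exp (s * generalizationGap loss t f) ∂(taskLaw τ m)
      ≤ Real.exp (s ^ 2 / (8 * m)) := by
  have hm' : (m : ℝ) ≠ 0 := by exact_mod_cast hm.ne'
  have hgm : Measurable fun t : Task Z m => generalizationGap loss t f :=
    (measurable_generalizationGap hloss).of_uncurry_right
  refine integral_taskLaw_le τ m (hgm.const_mul s).exp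
    (fun t => exp_mul_mem_Icc (generalizationGap_mem_Icc hm hloss hloss01 t f)) fun D => ?_
  refine le_trans (le_of_eq ?_) (integral_prod_exp_mean_sub_le (μ := (D : Measure Z)) hm
    (r := fun z => loss z f) hloss.of_uncurry_right (fun z => hloss01 z f) s)
  congr 1
  ext S
  rw [← Real.exp_sum, ← Finset.mul_sum, Finset.sum_sub_distrib, generalizationGap]
  congr 1
  simp
  field_simp

/-- PAC-Bayes bound at the task level, with the `n * m` independent samples pooled. The prior on
an algorithm and on the models it outputs on the `n` tasks is: `A` from `π`, then `P` from `𝓟 A`,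
then `n` independent models from `P`. -/
lemma exists_event_withinTask (hn : 0 < n) (hm : 0 < m) {loss : Z → F → ℝ}
    (hloss : Measurable (Function.uncurry loss)) (hloss01 : ∀ z f, loss z f ∈ Set.Icc (0 : ℝ) 1)
    {alg : 𝓐 → (Fin m → Z) → ProbabilityMeasure F} (halg : Measurable (Function.uncurry alg))
    (τ : ProbabilityMeasure (ProbabilityMeasure Z)) (π : ProbabilityMeasure 𝓐)
    {𝓟 : 𝓐 → ProbabilityMeasure (ProbabilityMeasure F)} (h𝓟 : Measurable 𝓟)
    {δ : ℝ} (hδ : 0 < δ) :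
    ∃ G : Set (Fin n → Task Z m), MeasurableSet G ∧ (trainingLaw τ n m).real Gᶜ ≤ δ ∧
      ∀ t ∈ G, ∀ (ρ : ProbabilityMeasure 𝓐) (𝓠 : 𝓐 → ProbabilityMeasure (ProbabilityMeasure F)),
        KL ρ π ≠ ⊤ →
        ∫⁻ A, complexity alg 𝓠 𝓟 (fun i => (t i).2) A ∂(ρ : Measure 𝓐) ≠ ⊤ →
        ∫ A, (1 / (n : ℝ)) * ∑ i, ∫ f, generalizationGap loss (t i) f
            ∂(alg A (t i).2 : Measure F) ∂(ρ : Measure 𝓐)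
        ≤ √(((KL ρ π).toReal
              + (∫⁻ A, complexity alg 𝓠 𝓟 (fun i => (t i).2) A ∂(ρ : Measure 𝓐)).toReal
              + Real.log (2 * √((n * m : ℕ) : ℝ) / δ)) / (2 * (n * m : ℕ))) := by
  have hn' : (n : ℝ) ≠ 0 := by exact_mod_cast hn.ne'
  have hm' : (m : ℝ) ≠ 0 := by exact_mod_cast hm.ne'
  have hgapm := measurable_generalizationGap (m := m) hloss
  have hgap := generalizationGap_mem_Icc (m := m) hm hloss hloss01
  have hgapt : ∀ t : Task Z m, Measurable (generalizationGap loss t) := fun t =>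
    hgapm.of_uncurry_left
  -- moments of the gaps under `P`, then under `𝓟 A`, then under `π`
  let u : ℝ → Task Z m → ProbabilityMeasure F → ℝ := fun l t P =>
    ∫ f, Real.exp (l / n * generalizationGap loss t f) ∂(P : Measure F)
  have hum : ∀ (l : ℝ), Measurable (Function.uncurry (u l)) := fun l =>
    measurable_integral_probabilityMeasure (X := Task Z m × ProbabilityMeasure F)
      (κ := fun p => p.2) (g := fun p f => Real.exp (l / n * generalizationGap loss p.1 f))
      measurable_snd ((hgapm.comp
        ((measurable_fst.comp measurable_fst).prodMk measurable_snd)).const_mul _).exp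
  have hu : ∀ (l : ℝ) t P, u l t P ∈ Set.Icc (Real.exp (-|l / n|)) (Real.exp |l / n|) :=
    fun l t P => integral_mem_Icc ((hgapt t).const_mul _).exp
      fun f => exp_mul_mem_Icc (hgap t f)
  let V : ℝ → (Fin n → Task Z m) → ProbabilityMeasure F → ℝ := fun l t P => ∏ i, u l (t i) P
  have hVm : ∀ (l : ℝ), Measurable (Function.uncurry (V l)) := fun l =>
    Finset.measurable_prod _ fun i _ => (hum l).comp
      (f := fun p : (Fin n → Task Z m) × ProbabilityMeasure F => (p.1 i, p.2)) (by fun_prop)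
  have hV : ∀ (l : ℝ) t P, V l t P ∈ Set.Icc (Real.exp (-|l / n|) ^ n) (Real.exp |l / n| ^ n) :=
    fun l t P => prod_mem_Icc_pow (Real.exp_pos _).le fun i => hu l (t i) P
  let U : ℝ → (Fin n → Task Z m) → 𝓐 → ℝ := fun l t A =>
    ∫ P, V l t P ∂(𝓟 A : Measure (ProbabilityMeasure F))
  have hUm : ∀ (l : ℝ), Measurable (Function.uncurry (U l)) := fun l =>
    measurable_integral_probabilityMeasure (X := (Fin n → Task Z m) × 𝓐)
      (κ := fun p => 𝓟 p.2) (g := fun p P => V l p.1 P)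
      (h𝓟.comp measurable_snd)
      ((hVm l).comp ((measurable_fst.comp measurable_fst).prodMk measurable_snd))
  have hVt : ∀ (l : ℝ) t, Measurable (V l t) := fun l t =>
    (hVm l).of_uncurry_left
  have hUt : ∀ (l : ℝ) t, Measurable (U l t) := fun l t =>
    (hUm l).of_uncurry_left
  have hU : ∀ (l : ℝ) t A, U l t A ∈ Set.Icc (Real.exp (-|l / n|) ^ n) (Real.exp |l / n| ^ n) :=
    fun l t A => integral_mem_Icc (hVt l t) (hV l t)
  let W : ℝ → (Fin n → Task Z m) → ℝ := fun l t => ∫ A, U l t A ∂(π : Measure 𝓐)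
  have hWm : ∀ (l : ℝ), Measurable (W l) := fun l =>
    measurable_integral_probabilityMeasure (κ := fun _ => π) measurable_const (hUm l)
  have hW : ∀ (l : ℝ) t, W l t ∈ Set.Icc (Real.exp (-|l / n|) ^ n) (Real.exp |l / n| ^ n) :=
    fun l t => integral_mem_Icc (hUt l t) (hU l t)
  have hmomu : ∀ (l : ℝ) P, ∫ t, u l t P ∂(taskLaw τ m) ≤ Real.exp ((l / n) ^ 2 / (8 * m)) :=
    fun l P => integral_integral_le_of_forall_le
      (g := fun t f => Real.exp (l / n * generalizationGap loss t f))
      (hgapm.const_mul _).exp (fun t f => exp_mul_mem_Icc (hgap t f))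
      fun f => integral_exp_generalizationGap_le hm hloss hloss01 τ (l / n) f
  have hmomV : ∀ (l : ℝ) P, ∫ t, V l t P ∂(trainingLaw τ n m)
      ≤ Real.exp (l ^ 2 / (8 * (n * m : ℕ))) := fun l P => by
    refine (integral_pi_prod_le n (φ := fun t => u l t P)
      (fun t => (Real.exp_pos _).le.trans (hu l t P).1) (hmomu l P)).trans_eq ?_
    congr 1
    push_cast
    field_simp
  have hmom : ∀ (l : ℝ), ∫ t, W l t ∂(trainingLaw τ n m) ≤ Real.exp (l ^ 2 / (8 * (n * m : ℕ))) :=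
    fun l => integral_integral_le_of_forall_le (hUm l) (hU l) fun A =>
      integral_integral_le_of_forall_le (hVm l) (hV l) (hmomV l)
  obtain ⟨G, hG, hGδ, hGx⟩ := exists_event_le_sqrt (Nat.mul_pos hn hm) hWm
    (fun l => integrable_of_forall_mem_Icc (hWm l) (hW l))
    (fun l t => (by positivity : (0 : ℝ) < Real.exp (-|l / n|) ^ n).trans_le (hW l t).1) hmom hδ
  refine ⟨G, hG, hGδ, fun t ht ρ 𝓠 hρ h𝓠 => ?_⟩
  let q : Fin n → 𝓐 → ℝ := fun i A =>
    ∫ f, generalizationGap loss (t i) f ∂(alg A (t i).2 : Measure F)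
  let g : 𝓐 → ℝ := fun A => (1 / (n : ℝ)) * ∑ i, q i A
  have hqm : ∀ i, Measurable (q i) := fun i =>
    measurable_integral_probabilityMeasure (κ := fun A => alg A (t i).2)
      (halg.comp (measurable_id.prodMk measurable_const)) ((hgapt (t i)).comp measurable_snd)
  have hq : ∀ i A, q i A ∈ Set.Icc (-1 : ℝ) 1 := fun i A =>
    integral_mem_Icc (hgapt (t i)) (hgap (t i))
  have hgm : Measurable g := (Finset.measurable_sum _ fun i _ => hqm i).const_mul _
  have hg : ∀ A, g A ∈ Set.Icc (-1 : ℝ) 1 := fun A => average_mem_Icc hn fun i => hq i A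
  refine hGx t ht _ _ (integral_mem_Icc hgm hg).2 fun l => ?_
  have hpow : (0 : ℝ) < Real.exp (-|l / n|) ^ n := by positivity
  -- the change of measure for the `n` models given `P`
  have hmodels : ∀ A P, ENNReal.ofReal (l * g A - Real.log (V l t P))
      ≤ ∑ i, KL (alg A (t i).2) P := fun A P => by
    have hi : ∀ i, ENNReal.ofReal (l / n * q i A - Real.log (u l (t i) P))
        ≤ KL (alg A (t i).2) P := fun i => by
      have h := ofReal_integral_sub_log_integral_exp_le_KL (alg A (t i).2) P
        ((hgapt (t i)).const_mul (l / n)) (a := -|l / n|) (b := |l / n|) fun f => by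
          have := exp_mul_mem_Icc (s := l / n) (hgap (t i) f)
          exact ⟨Real.exp_le_exp.1 this.1, Real.exp_le_exp.1 this.2⟩
      rwa [integral_const_mul] at h
    have hsum : l * g A - Real.log (V l t P)
        = ∑ i, (l / n * q i A - Real.log (u l (t i) P)) := by
      rw [Finset.sum_sub_distrib, ← Finset.mul_sum, Real.log_prod
        fun i _ => ((Real.exp_pos _).trans_le (hu l (t i) P).1).ne']
      simp only [g]
      ring
    rw [hsum]
    exact (Finset.le_sum_of_subadditive ENNReal.ofReal ENNReal.ofReal_zero.le
      (fun _ _ => ENNReal.ofReal_add_le) _ _).trans (Finset.sum_le_sum fun i _ => hi i)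
  -- the change of measure for `P` given `A`
  have hcomplexity : ∀ A, ENNReal.ofReal (l * g A - Real.log (U l t A))
      ≤ complexity alg 𝓠 𝓟 (fun i => (t i).2) A := fun A => by
    have h := ofReal_integral_sub_log_integral_le_KL_add_lintegral (𝓠 A) (𝓟 A)
      (a := fun _ => l * g A) measurable_const (hVt l t) (fun _ => ⟨le_rfl, le_rfl⟩) hpow
      (hV l t) (hmodels A)
    rwa [integral_const, probReal_univ, one_smul] at h
  have hlg : ∀ A, l * g A ∈ Set.Icc (-|l|) |l| := fun A => by
    have := exp_mul_mem_Icc (s := l) (hg A)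
    exact ⟨Real.exp_le_exp.1 this.1, Real.exp_le_exp.1 this.2⟩
  have h := ofReal_integral_sub_log_integral_le_KL_add_lintegral ρ π (hgm.const_mul l)
    (hUt l t) hlg hpow (hU l t) hcomplexity
  rw [integral_const_mul] at h
  rw [← ENNReal.toReal_add hρ h𝓠]
  exact (ENNReal.ofReal_le_iff_le_toReal (ENNReal.add_ne_top.2 ⟨hρ, h𝓠⟩)).1 h

end WithinTask

/-! ### Stochastic models and the union bound -/

lemma measurable_stochLoss {Z F X : Type*} [MeasurableSpace Z] [MeasurableSpace F]
    [MeasurableSpace X] {loss : Z → F → ℝ} (hloss : Measurable (Function.uncurry loss))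
    {z : X → Z} (hz : Measurable z) {Q : X → ProbabilityMeasure F} (hQ : Measurable Q) :
    Measurable fun x => stochLoss loss (z x) (Q x) :=
  measurable_integral_probabilityMeasure (g := fun x f => loss (z x) f) hQ
    (hloss.comp ((hz.comp measurable_fst).prodMk measurable_snd))

lemma integral_generalizationGap {Z F : Type*} [MeasurableSpace Z] [MeasurableSpace F] {m : ℕ}
    {loss : Z → F → ℝ} (hloss : Measurable (Function.uncurry loss))
    (hloss01 : ∀ z f, loss z f ∈ Set.Icc (0 : ℝ) 1) (t : Task Z m) (Q : ProbabilityMeasure F) :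
    ∫ f, generalizationGap loss t f ∂(Q : Measure F)
      = ∫ z, stochLoss loss z Q ∂(t.1 : Measure Z)
        - (1 / (m : ℝ)) * ∑ j, stochLoss loss (t.2 j) Q := by
  have hi : Integrable (Function.uncurry loss) ((t.1 : Measure Z).prod (Q : Measure F)) :=
    integrable_of_forall_mem_Icc hloss fun p => hloss01 p.1 p.2
  have hj : ∀ z, Integrable (loss z) (Q : Measure F) := fun z =>
    integrable_of_forall_mem_Icc hloss.of_uncurry_left (hloss01 z)
  unfold generalizationGap stochLoss
  have hi' : Integrable (fun f => ∫ z, loss z f ∂(t.1 : Measure Z)) (Q : Measure F) :=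
    hi.integral_prod_right
  rw [integral_sub hi' ((integrable_finsetSum _ fun j _ => hj (t.2 j)).const_mul _), integral_const_mul,
    integral_finsetSum _ fun j _ => hj (t.2 j), integral_integral_swap hi]

end MetaLearning

open MetaLearning in
theorem theorem1
    {Z F 𝓐 : Type*} [MeasurableSpace Z] [MeasurableSpace F] [MeasurableSpace 𝓐]
    (n m : ℕ) (hn : 0 < n) (hm : 0 < m)
    -- a measurable loss with values in `[0, 1]`
    (loss : Z → F → ℝ) (hloss : Measurable (Function.uncurry loss))
    (hloss01 : ∀ z f, loss z f ∈ Set.Icc (0 : ℝ) 1)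
    -- the stochastic learning algorithms: `alg A S` is the output of `A` on the dataset `S`
    (alg : 𝓐 → (Fin m → Z) → ProbabilityMeasure F) (halg : Measurable (Function.uncurry alg))
    -- the task environment
    (τ : ProbabilityMeasure (ProbabilityMeasure Z))
    -- the meta-prior and the hyper-prior mapping
    (π : ProbabilityMeasure 𝓐)
    (𝓟 : 𝓐 → ProbabilityMeasure (ProbabilityMeasure F)) (h𝓟 : Measurable 𝓟)
    (δ : ℝ) (hδ : 0 < δ) :
    -- an event `G` of probability at least `1 - δ` over the training tasks `t`
    ∃ G : Set (Fin n → Task Z m), MeasurableSet G ∧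
      ENNReal.ofReal (1 - δ) ≤ trainingLaw τ n m G ∧
      ∀ t ∈ G, ∀ (ρ : ProbabilityMeasure 𝓐) (𝓠 : 𝓐 → ProbabilityMeasure (ProbabilityMeasure F)),
        -- the right-hand side is `+∞`, and nothing is claimed, if one of these is infinite
        KL ρ π ≠ ⊤ →
        ∫⁻ A, complexity alg 𝓠 𝓟 (fun i => (t i).2) A ∂(ρ : Measure 𝓐) ≠ ⊤ →
        futureRisk loss alg τ ρ ≤
          empiricalRisk loss alg (fun i => (t i).2) ρ
          + √(((KL ρ π).toReal + Real.log (4 * √(n : ℝ) / δ)) / (2 * n))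
          + √(((KL ρ π).toReal
                + (∫⁻ A, complexity alg 𝓠 𝓟 (fun i => (t i).2) A ∂(ρ : Measure 𝓐)).toReal
                + Real.log (8 * m * n / δ) + 1) / (2 * m * n)) := by
  -- the expected loss, on the data distribution of `t`, of the output of `A` on the dataset of `t`
  let r : Task Z m → 𝓐 → ℝ := fun t A => ∫ z, stochLoss loss z (alg A t.2) ∂(t.1 : Measure Z)
  have hsl01 : ∀ z Q, stochLoss loss z Q ∈ Set.Icc (0 : ℝ) 1 := fun z Q =>
    integral_mem_Icc hloss.of_uncurry_left (hloss01 z)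
  have hslm : ∀ Q, Measurable fun z => stochLoss loss z Q := fun Q =>
    measurable_stochLoss hloss measurable_id measurable_const
  have hr : Measurable (Function.uncurry r) :=
    measurable_integral_probabilityMeasure (X := Task Z m × 𝓐) (κ := fun p => p.1.1)
      (g := fun p z => stochLoss loss z (alg p.2 p.1.2)) (by fun_prop)
      (measurable_stochLoss hloss measurable_snd
        (halg.comp (f := fun q : (Task Z m × 𝓐) × Z => (q.1.2, q.1.1.2)) (by fun_prop)))
  have hr01 : ∀ t A, r t A ∈ Set.Icc (0 : ℝ) 1 := fun t A =>
    integral_mem_Icc (hslm _) fun z => hsl01 z _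
  obtain ⟨G₁, hG₁, hδ₁, h₁⟩ := exists_event_environment hn τ π hr hr01 (half_pos hδ)
  obtain ⟨G₂, hG₂, hδ₂, h₂⟩ :=
    exists_event_withinTask hn hm hloss hloss01 halg τ π h𝓟 (half_pos hδ)
  refine ⟨G₁ ∩ G₂, hG₁.inter hG₂, ?_, fun t ht ρ 𝓠 hρ h𝓠 => ?_⟩
  · have hc : (trainingLaw τ n m).real (G₁ ∩ G₂)ᶜ ≤ δ := by
      rw [Set.compl_inter]
      linarith [measureReal_union_le (μ := trainingLaw τ n m) G₁ᶜ G₂ᶜ]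
    rw [probReal_compl_eq_one_sub (hG₁.inter hG₂)] at hc
    exact ENNReal.ofReal_le_of_le_toReal (by rw [← measureReal_def]; linarith)
  have b₁ := h₁ t ht.1 ρ hρ
  have b₂ := h₂ t ht.2 ρ 𝓠 hρ h𝓠
  have hmid : Integrable (fun A => (1 / (n : ℝ)) * ∑ i, r (t i) A) (ρ : Measure 𝓐) :=
    (integrable_finsetSum _ fun i _ =>
      integrable_of_forall_mem_Icc hr.of_uncurry_left (hr01 (t i))).const_mul _
  have hemp : Integrable (fun A => (1 / (n : ℝ)) * ∑ i, (1 / (m : ℝ)) *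
      ∑ j, stochLoss loss ((t i).2 j) (alg A (t i).2)) (ρ : Measure 𝓐) :=
    (integrable_finsetSum _ fun i _ => (integrable_finsetSum _ fun j _ =>
      integrable_of_forall_mem_Icc (measurable_stochLoss hloss measurable_const
        halg.of_uncurry_right) fun A => hsl01 _ _).const_mul _).const_mul _
  have hgap : ∫ A, (1 / (n : ℝ)) * ∑ i, ∫ f, generalizationGap loss (t i) f
        ∂(alg A (t i).2 : Measure F) ∂(ρ : Measure 𝓐)
      = ∫ A, (1 / (n : ℝ)) * ∑ i, r (t i) A ∂(ρ : Measure 𝓐)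
        - empiricalRisk loss alg (fun i => (t i).2) ρ := by
    rw [empiricalRisk, ← integral_sub hmid hemp]
    simp_rw [integral_generalizationGap hloss hloss01, Finset.sum_sub_distrib, mul_sub]
    rfl
  rw [hgap] at b₂
  have e₁ : 2 * √(n : ℝ) / (δ / 2) = 4 * √(n : ℝ) / δ := by field_simp; norm_num
  rw [e₁] at b₁
  have hn1 : (1 : ℝ) ≤ n := by exact_mod_cast hn
  have hm1 : (1 : ℝ) ≤ m := by exact_mod_cast hm
  have hlog : Real.log (2 * √((n * m : ℕ) : ℝ) / (δ / 2)) ≤ Real.log (8 * m * n / δ) + 1 := by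
    have hnm : (1 : ℝ) ≤ n * m := one_le_mul_of_one_le_of_one_le hn1 hm1
    have hsqrt : √(n * m : ℝ) ≤ n * m := Real.sqrt_le_iff.2 ⟨by linarith, by nlinarith⟩
    have hpos : (0 : ℝ) < √(n * m : ℝ) := Real.sqrt_pos.2 (by linarith)
    refine le_trans (Real.log_le_log ?_ ?_) (le_add_of_nonneg_right zero_le_one)
    · push_cast; positivity
    · push_cast
      rw [div_div_eq_mul_div]
      refine div_le_div_of_nonneg_right ?_ hδ.le
      nlinarith
  have hmono : √(((KL ρ π).toReal
        + (∫⁻ A, complexity alg 𝓠 𝓟 (fun i => (t i).2) A ∂(ρ : Measure 𝓐)).toReal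
        + Real.log (2 * √((n * m : ℕ) : ℝ) / (δ / 2))) / (2 * (n * m : ℕ)))
      ≤ √(((KL ρ π).toReal
        + (∫⁻ A, complexity alg 𝓠 𝓟 (fun i => (t i).2) A ∂(ρ : Measure 𝓐)).toReal
        + Real.log (8 * m * n / δ) + 1) / (2 * m * n)) := by
    rw [show (2 * (n * m : ℕ) : ℝ) = 2 * m * n by push_cast; ring]
    refine Real.sqrt_le_sqrt (div_le_div_of_nonneg_right ?_ (by positivity))
    linarith
  have hfuture : futureRisk loss alg τ ρ = ∫ A, ∫ s, r s A ∂(taskLaw τ m) ∂(ρ : Measure 𝓐) := rfl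
  rw [hfuture]
  linarith
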